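/- Let $n\ge 1$ be an integer and let $\mathbb U=\{z\in\mathbb C:|z|<1\}$. Let $\mathcal A_n$ be the class of functions $f$ analytic in $\mathbb U$ of the form $f(z)=z+a_{n+1}z^{n+1}+a_{n+2}z^{n+2}+\cdots$. For $0<\mu\le 1$ let $\mathcal{STS}(\mu)$ be the class of those $f\in\mathcal A_n$ such that $$\left|\arg\frac{zf'(z)}{f(z)}\right|<\frac{\pi}{2}\mu\qquad(z\in\mathbb U),$$ where the quotient takes its limit value $1$ at $z=0$. Here $\arg$ is the principal argument, and a bound on $\arg w$ includes the assertion that $w$ is defined and $w\neq 0$. Put $$\phi(\mu)=\frac{\pi}{2}(\mu+1)-\arctan\frac{\cos\frac{\mu\pi}{2}}{\sin\frac{\mu\pi}{2}+\frac{n\mu}{1-\mu}\left(\frac{1-\mu}{1+\mu}\right)^{\frac{1+\mu}{2}}}\quad(0<\mu<1),\qquad \phi(1)=\pi .$$ Let $\alpha,\gamma>0$, $\beta\in\mathbb R$ and $0<\mu\le 1$ satisfy $$\alpha=\beta+\frac{2}{\pi}\arctan(n\beta),\qquad \beta=\gamma+\frac{2}{\pi}\arctan(n\gamma),\qquad \frac{\pi}{2}(\alpha+\gamma)\le\phi(\mu).$$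 If $f\in\mathcal A_n$ satisfies $$|\arg f'(z)|<\frac{\pi}{2}\alpha\qquad(z\in\mathbb U),$$ then the Alexander integral $$F(z)=\int_0^z\frac{f(t)}{t}\,dt\qquad(z\in\mathbb U)$$ of $f$ belongs to $\mathcal{STS}(\mu)$. -/

import Mathlib

noncomputable section

/-- The class `𝒜ₙ`: functions analytic in the open unit disk whose expansion at the origin is
`f(z) = z + a_{n+1} z^{n+1} + a_{n+2} z^{n+2} + ⋯`. -/
def classA (n : ℕ) : Set (ℂ → ℂ) :=
  {f | AnalyticOnNhd ℂ f (Metric.ball 0 1) ∧ f 0 = 0 ∧ deriv f 0 = 1 ∧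
    ∀ k : ℕ, 2 ≤ k → k ≤ n → iteratedDeriv k f 0 = 0}

/-- `|arg w| < r` for the principal argument; the argument is defined only for `w ≠ 0`. -/
def AbsArgLT (w : ℂ) (r : ℝ) : Prop :=
  w ≠ 0 ∧ |Complex.arg w| < r

/-- The class `𝒮𝒯𝒮(μ)` of `f ∈ 𝒜ₙ` with `|arg (z f'(z) / f(z))| < (π/2) μ` in the unit disk.
At `z = 0` the quotient has the removable value `1`, whose argument is `0`, so only `z ≠ 0`
has to be tested. -/
def classSTS (n : ℕ) (μ : ℝ) : Set (ℂ → ℂ) :=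
  {f | f ∈ classA n ∧ ∀ z ∈ Metric.ball (0 : ℂ) 1, z ≠ 0 →
    f z ≠ 0 ∧ AbsArgLT (z * deriv f z / f z) (Real.pi / 2 * μ)}

/-- The Alexander integral `F(z) = ∫₀ᶻ f(t)/t dt`, along the segment `t = s z`, `0 ≤ s ≤ 1`. -/
def alexander (f : ℂ → ℂ) (z : ℂ) : ℂ :=
  ∫ s in (0 : ℝ)..1, f ((s : ℂ) * z) / ((s : ℂ) * z) * z

/-- The bound `φ(μ)`, for `0 < μ ≤ 1`. At `μ = 1` it is `π`, see `phiBound_one`. -/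
def phiBound (n : ℕ) (μ : ℝ) : ℝ :=
  Real.pi / 2 * (μ + 1) -
    Real.arctan (Real.cos (μ * Real.pi / 2) /
      (Real.sin (μ * Real.pi / 2) +
        (n : ℝ) * μ / (1 - μ) * ((1 - μ) / (1 + μ)) ^ ((1 + μ) / 2)))

/-- The value at `μ = 1` is the limit of the formula as `μ → 1`, because the cosine vanishes
and the denominator tends to `1 + n / 2`. -/
theorem phiBound_one (n : ℕ) : phiBound n 1 = Real.pi := by
  simp [phiBound]
  ring

end

/-!
Since `φ(μ) ≤ π`, the hypotheses force `α + γ ≤ 2`, hence `γ ≤ β ≤ 1`, so all sectors to be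
tested lie in the right half-plane.

Suppose `p` is analytic with `p(z) = 1 + c zⁿ + ⋯` and leaves the sector `|arg| < πβ/2`, first at
`z₀`. If `p(z₀) ≠ 0`, Jack's lemma for the Cayley transform of `p ^ (1/β)` gives Nunokawa's relation
`z₀ p'(z₀) / p(z₀) = i (2/π) k arg p(z₀)` with `k ≥ (n/2) (a + 1/a)`, `a = |p(z₀)| ^ (1/β)`; if
`p(z₀) = 0`, then `z₀ p'(z₀) ≤ 0`.

For `p + z p'` the relation reads `|arg (p + z p')| ≥ πβ/2 + arctan (n β)` at `z₀`. Applied first to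
`p = f/z`, for which `p + z p' = f'`, and then to `q = F/z`, for which `q + z q' = p`, this bounds
`|arg p|` by `πβ/2` and `|arg q|` by `πγ/2`. The quotient `P = p/q = z F'/F` satisfies
`P² + z P' = f'/q`, whose argument is therefore less than `π(α + γ)/2 ≤ φ(μ)`. If `P` left the
sector `|arg| < πμ/2`, then Nunokawa's relation and the weighted AM-GM inequality would make
`|arg (P² + z P')|` at least `φ(μ)`.
-/

open Complex Metric Filter Topology
open scoped ComplexOrder ComplexConjugate

theorem norm_mul_cos_abs_arg (w : ℂ) : ‖w‖ * Real.cos |arg w| = w.re := by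
  rw [Real.cos_abs, norm_mul_cos_arg]

theorem absArgLT_iff {w : ℂ} {θ : ℝ} (h0 : 0 ≤ θ) (hπ : θ ≤ Real.pi) :
    AbsArgLT w θ ↔ ‖w‖ * Real.cos θ < w.re := by
  rcases eq_or_ne w 0 with rfl | hw
  · simp [AbsArgLT]
  · rw [AbsArgLT, and_iff_right hw, ← norm_mul_cos_abs_arg,
      mul_lt_mul_iff_right₀ (norm_pos_iff.2 hw),
      Real.strictAntiOn_cos.lt_iff_gt ⟨h0, hπ⟩ ⟨abs_nonneg _, abs_arg_le_pi w⟩]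

theorem abs_arg_le_iff {w : ℂ} {θ : ℝ} (h0 : 0 ≤ θ) (hπ : θ ≤ Real.pi) :
    |arg w| ≤ θ ↔ ‖w‖ * Real.cos θ ≤ w.re := by
  rcases eq_or_ne w 0 with rfl | hw
  · simp [h0]
  · rw [← norm_mul_cos_abs_arg, mul_le_mul_iff_right₀ (norm_pos_iff.2 hw),
      Real.strictAntiOn_cos.le_iff_ge ⟨h0, hπ⟩ ⟨abs_nonneg _, abs_arg_le_pi w⟩]

theorem AbsArgLT.div {v w : ℂ} {a b : ℝ} (hv : AbsArgLT v a) (hw : AbsArgLT w b)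
    (hab : a + b ≤ Real.pi) : AbsArgLT (v / w) (a + b) := by
  have hwinv : |arg w⁻¹| < b := by rw [abs_arg_inv]; exact hw.2
  have hsum : |arg v + arg w⁻¹| < a + b :=
    (abs_add_le _ _).trans_lt (add_lt_add hv.2 hwinv)
  have hmem := abs_lt.1 (hsum.trans_le hab)
  refine ⟨div_ne_zero hv.1 hw.1, ?_⟩
  rwa [div_eq_mul_inv, arg_mul hv.1 (inv_ne_zero hw.1) ⟨hmem.1, hmem.2.le⟩]

theorem AbsArgLT.not_nonpos {w : ℂ} {θ : ℝ} (h : AbsArgLT w θ) (hθ : θ ≤ Real.pi) :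
    ¬ w ≤ 0 := by
  intro hw
  have hlt := h.2.trans_le hθ
  have harg : arg w = Real.pi := arg_eq_pi_iff_lt_zero.2 (hw.lt_of_ne h.1)
  rw [harg, abs_of_pos Real.pi_pos] at hlt
  exact hlt.false

theorem abs_arg_conj (w : ℂ) : |arg (conj w)| = |arg w| := by
  rw [arg_conj]
  split_ifs <;> simp [*]

theorem arg_eq_arctan_of_re_pos {w : ℂ} (hw : 0 < w.re) : arg w = Real.arctan (w.im / w.re) := by
  have h := abs_lt.1 (abs_arg_lt_pi_div_two_iff.2 (Or.inl hw))
  rw [← tan_arg, Real.arctan_tan h.1 h.2]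

theorem arg_eq_pi_div_two_sub_arctan_of_im_pos {w : ℂ} (hw : 0 < w.im) :
    arg w = Real.pi / 2 - Real.arctan (w.re / w.im) := by
  have hre : 0 < (-I * w).re := by simpa
  have h := arg_eq_arctan_of_re_pos hre
  have hne : -I * w ≠ 0 := fun h0 => by simp [h0] at hre
  have hmem := abs_lt.1 (abs_arg_lt_pi_div_two_iff.2 (Or.inl hre))
  have hw' : w = I * (-I * w) := by rw [← mul_assoc]; simp
  conv_lhs => rw [hw']
  rw [arg_mul I_ne_zero hne (by rw [arg_I]; constructor <;> linarith), arg_I, h]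
  simp [neg_div, Real.arctan_neg, sub_eq_add_neg]

theorem nonneg_mul_deriv_of_isMaxOn_re {u : ℂ → ℂ} {z₀ : ℂ} (hu : DifferentiableAt ℂ u z₀)
    (hmax : IsMaxOn (fun z => (u z).re) (closedBall 0 ‖z₀‖) z₀) : 0 ≤ z₀ * deriv u z₀ := by
  set A := z₀ * deriv u z₀ with hA
  rcases eq_or_ne A 0 with h0 | h0
  · exact h0.ge
  have hA0 : ‖A‖ ≠ 0 := norm_ne_zero_iff.2 h0
  -- Test the first order condition in the direction of the point `y` of the circle at which the
  -- increment `(y - z₀) u'(z₀)` has the largest real part, namely `‖A‖ - A.re`.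
  set y := z₀ * (conj A / ‖A‖) with hy
  have hynorm : ‖y‖ = ‖z₀‖ := by
    rw [hy, norm_mul, norm_div, norm_conj, norm_real, norm_norm, div_self hA0, mul_one]
  have hseg : segment ℝ z₀ y ⊆ closedBall 0 ‖z₀‖ :=
    (convex_closedBall 0 _).segment_subset (by simp) (by simp [hynorm])
  have hderiv : HasFDerivAt (fun z => (u z).re) (reCLM ∘SL (deriv u z₀ • (1 : ℂ →L[ℝ] ℂ))) z₀ :=
    reCLM.hasFDerivAt.comp z₀ hu.hasDerivAt.complexToReal_fderiv
  have hle := hmax.localize.hasFDerivWithinAt_nonpos hderiv.hasFDerivWithinAt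
    (sub_mem_posTangentConeAt_of_segment_subset hseg)
  have hincr : deriv u z₀ * (y - z₀) = ‖A‖ - A := by
    have : A * conj A / ‖A‖ = ‖A‖ := by
      rw [mul_conj, normSq_eq_norm_sq]
      push_cast
      field_simp
    rw [hy]
    linear_combination this - (conj A / ‖A‖ - 1) * hA
  have hre : ‖A‖ - A.re ≤ 0 := by
    have := congrArg re hincr
    simp only [sub_re, ofReal_re] at this
    rw [← this]
    simpa using hle
  exact re_eq_norm.1 ((re_le_norm A).antisymm (by linarith))

theorem nonneg_mul_logDeriv_of_isMaxOn_norm {h : ℂ → ℂ} {z₀ : ℂ} (hh : DifferentiableAt ℂ h z₀)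
    (hmax : IsMaxOn (fun z => ‖h z‖) (closedBall 0 ‖z₀‖) z₀) : 0 ≤ z₀ * logDeriv h z₀ := by
  rcases eq_or_ne (h z₀) 0 with h0 | h0
  · simp [logDeriv_apply, h0]
  have hre : IsMaxOn (fun z => (h z / h z₀).re) (closedBall 0 ‖z₀‖) z₀ := by
    intro z hz
    calc (h z / h z₀).re ≤ ‖h z / h z₀‖ := re_le_norm _
      _ ≤ 1 := by
        rw [norm_div]
        exact div_le_one_of_le₀ (hmax hz) (norm_nonneg _)
      _ = (h z₀ / h z₀).re := by rw [div_self h0, one_re]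
  have := nonneg_mul_deriv_of_isMaxOn_re (hh.div_const _) hre
  rwa [deriv_div_const] at this

theorem norm_le_mul_div_pow_of_le_analyticOrderAt {w : ℂ → ℂ} {R M : ℝ} {n : ℕ} {z : ℂ}
    (hw : DifferentiableOn ℂ w (ball 0 R)) (hM : ∀ z ∈ ball (0 : ℂ) R, ‖w z‖ ≤ M)
    (hn : n ≤ analyticOrderAt w 0) (hz : z ∈ ball 0 R) : ‖w z‖ ≤ M * (‖z‖ / R) ^ n := by
  obtain _ | n := n
  · simpa using hM z hz
  have han : AnalyticAt ℂ w 0 := hw.analyticAt (ball_mem_nhds _ (nonempty_ball.1 ⟨z, hz⟩))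
  obtain ⟨g, hg, hwg⟩ := (natCast_le_analyticOrderAt han).1 hn
  have hw0 : w 0 = 0 := by simpa using hwg.self_of_nhds
  have hlittle : (w · - w 0) =o[𝓝 0] fun z => ‖z - 0‖ ^ n := by
    have := (Asymptotics.isLittleO_pow_pow (𝕜 := ℂ) n.lt_succ_self).mul_isBigO
      (hg.continuousAt.tendsto.isBigO_one ℂ)
    refine ((EventuallyEq.trans_isLittleO ?_ this).norm_right).congr_right fun z => by simp
    filter_upwards [hwg] with z hz using by simp [hz, hw0]
  simpa [hw0] using dist_le_mul_div_pow_of_mapsTo_ball_of_isLittleO hw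
    (fun z hz => by simpa [hw0] using hM z hz) hlittle hz

-- Jack's lemma: by the Schwarz lemma, `‖w z / z ^ n‖` is maximal at `z₀` as well.
theorem natCast_le_mul_logDeriv_of_isMaxOn_norm {w : ℂ → ℂ} {z₀ : ℂ} {n : ℕ}
    (hw : DifferentiableOn ℂ w (ball 0 ‖z₀‖)) (hwz₀ : DifferentiableAt ℂ w z₀)
    (hmax : IsMaxOn (fun z => ‖w z‖) (closedBall 0 ‖z₀‖) z₀) (hw₀ : w z₀ ≠ 0)
    (hn : n ≤ analyticOrderAt w 0) : n ≤ z₀ * logDeriv w z₀ := by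
  obtain _ | k := n
  · simpa using nonneg_mul_logDeriv_of_isMaxOn_norm hwz₀ hmax
  set n := k + 1 with hnk
  have hz₀ : z₀ ≠ 0 := by
    rintro rfl
    refine hw₀ (apply_eq_zero_of_analyticOrderAt_ne_zero fun h => ?_)
    simp [h, hnk] at hn
  have hquot : IsMaxOn (fun z => ‖w z / z ^ n‖) (closedBall 0 ‖z₀‖) z₀ := by
    intro z hz
    simp only [Set.mem_ofPred_eq, norm_div, norm_pow]
    rw [mem_closedBall_zero_iff] at hz
    rcases eq_or_ne z 0 with rfl | hz0
    · simpa [hnk] using (by positivity : 0 ≤ ‖w z₀‖ / ‖z₀‖ ^ n)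
    have : 0 < ‖z‖ := norm_pos_iff.2 hz0
    rw [div_le_iff₀ (by positivity), div_mul_eq_mul_div, mul_div_assoc, ← div_pow]
    rcases hz.eq_or_lt with heq | hlt
    · rw [heq, div_self (norm_ne_zero_iff.2 hz₀), one_pow, mul_one]
      exact hmax (by simp [heq])
    · exact norm_le_mul_div_pow_of_le_analyticOrderAt hw
        (fun y hy => hmax (ball_subset_closedBall hy)) hn (by simpa using hlt)
  have hpow : z₀ ^ n ≠ 0 := pow_ne_zero n hz₀
  have := nonneg_mul_logDeriv_of_isMaxOn_norm (hwz₀.fun_div (by fun_prop) hpow) hquot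
  rw [logDeriv_div z₀ hw₀ hpow hwz₀ (by fun_prop), logDeriv_pow] at this
  rwa [mul_sub, mul_div_cancel₀ _ hz₀, sub_nonneg] at this

/-- The conformal map of the sector `|arg u| < πβ/2` onto the unit disk with `1 ↦ 0`: the power
`u ↦ u ^ (1/β)` onto the right half-plane, followed by the Cayley transform. -/
noncomputable def sectorToDisk (β : ℝ) (u : ℂ) : ℂ :=
  (u ^ (β⁻¹ : ℂ) - 1) / (u ^ (β⁻¹ : ℂ) + 1)

theorem sectorToDisk_one (β : ℝ) : sectorToDisk β 1 = 0 := by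
  simp [sectorToDisk]

theorem norm_sub_one_le_norm_add_one {q : ℂ} (hq : 0 ≤ q.re) : ‖q - 1‖ ≤ ‖q + 1‖ := by
  rw [← sq_le_sq₀ (norm_nonneg _) (norm_nonneg _), ← normSq_eq_norm_sq, ← normSq_eq_norm_sq,
    normSq_apply, normSq_apply]
  simp only [sub_re, sub_im, add_re, add_im, one_re, one_im]
  nlinarith

theorem re_cpow_inv_nonneg {β : ℝ} {u : ℂ} (hβ : 0 < β) (hu : |arg u| ≤ Real.pi / 2 * β) :
    0 ≤ (u ^ (β⁻¹ : ℂ)).re := by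
  have hangle : |arg u * β⁻¹| ≤ Real.pi / 2 := by
    rw [abs_mul, abs_of_pos (inv_pos.2 hβ), ← div_eq_mul_inv]
    exact (div_le_iff₀ hβ).2 hu
  rw [← ofReal_inv, cpow_ofReal_re]
  exact mul_nonneg (by positivity) (Real.cos_nonneg_of_mem_Icc (abs_le.1 hangle))

theorem cpow_inv_add_one_ne_zero {β : ℝ} {u : ℂ} (hβ : 0 < β) (hu : |arg u| ≤ Real.pi / 2 * β) :
    u ^ (β⁻¹ : ℂ) + 1 ≠ 0 := by
  intro h
  have := congrArg re h
  simp only [add_re, one_re, zero_re] at this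
  linarith [re_cpow_inv_nonneg hβ hu]

theorem cpow_inv_of_abs_arg_eq {β : ℝ} {u : ℂ} (hβ : 0 < β) (hu : |arg u| = Real.pi / 2 * β) :
    u ^ (β⁻¹ : ℂ) = (‖u‖ ^ β⁻¹ : ℝ) * (2 / Real.pi * arg u / β : ℝ) * I := by
  rw [← ofReal_inv, cpow_ofReal, mul_assoc]
  congr 1
  have := Real.pi_pos
  rcases abs_eq (by positivity) |>.1 hu with h | h
  · have hangle : arg u * β⁻¹ = Real.pi / 2 := by rw [h]; field_simp
    have hsign : 2 / Real.pi * arg u / β = 1 := by rw [h]; field_simp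
    rw [hangle, hsign, Real.cos_pi_div_two, Real.sin_pi_div_two]
    simp
  · have hangle : arg u * β⁻¹ = -(Real.pi / 2) := by rw [h]; field_simp
    have hsign : 2 / Real.pi * arg u / β = -1 := by rw [h]; field_simp
    rw [hangle, hsign, Real.cos_neg, Real.sin_neg, Real.cos_pi_div_two, Real.sin_pi_div_two]
    simp

theorem norm_sectorToDisk_le_one {β : ℝ} {u : ℂ} (hβ : 0 < β) (hu : |arg u| ≤ Real.pi / 2 * β) :
    ‖sectorToDisk β u‖ ≤ 1 := by
  rw [sectorToDisk, norm_div]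
  exact div_le_one_of_le₀ (norm_sub_one_le_norm_add_one (re_cpow_inv_nonneg hβ hu))
    (norm_nonneg _)

theorem norm_sectorToDisk_eq_one {β : ℝ} {u : ℂ} (hβ : 0 < β) (hu : |arg u| = Real.pi / 2 * β) :
    ‖sectorToDisk β u‖ = 1 := by
  have hne := cpow_inv_add_one_ne_zero hβ hu.le
  rw [sectorToDisk, norm_div, div_eq_one_iff_eq (norm_ne_zero_iff.2 hne),
    ← norm_neg, ← norm_conj, cpow_inv_of_abs_arg_eq hβ hu]
  congr 1
  simp only [map_neg, map_sub, map_mul, conj_ofReal, conj_I, map_one]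
  ring

theorem analyticAt_sectorToDisk {β : ℝ} {u : ℂ} (hu : u ∈ slitPlane)
    (hne : u ^ (β⁻¹ : ℂ) + 1 ≠ 0) : AnalyticAt ℂ (sectorToDisk β) u := by
  have hpow : AnalyticAt ℂ (fun u : ℂ => u ^ (β⁻¹ : ℂ)) u :=
    analyticAt_id.cpow analyticAt_const hu
  exact (hpow.fun_sub analyticAt_const).fun_div (hpow.fun_add analyticAt_const) hne

theorem mul_logDeriv_sectorToDisk {β : ℝ} {u : ℂ} (hu : u ∈ slitPlane)
    (hne : u ^ (β⁻¹ : ℂ) + 1 ≠ 0) :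
    u * logDeriv (sectorToDisk β) u =
      2 / (β * (u ^ (β⁻¹ : ℂ) - (u ^ (β⁻¹ : ℂ))⁻¹)) := by
  have hu0 := slitPlane_ne_zero hu
  have hq0 : u ^ (β⁻¹ : ℂ) ≠ 0 := by simp [cpow_eq_zero_iff, hu0]
  set q := u ^ (β⁻¹ : ℂ) with hq
  have hderiv : deriv (sectorToDisk β) u = 2 * ((β⁻¹ : ℂ) * (q / u)) / (q + 1) ^ 2 := by
    have hpow : HasDerivAt (fun u : ℂ => u ^ (β⁻¹ : ℂ)) ((β⁻¹ : ℂ) * (q / u)) u := by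
      refine (hasStrictDerivAt_cpow_const hu).hasDerivAt.congr_deriv ?_
      rw [cpow_sub _ _ hu0, cpow_one]
    refine ((hpow.sub_const 1).fun_div (hpow.add_const 1) hne).deriv.trans ?_
    ring
  rw [logDeriv_apply, hderiv, sectorToDisk, ← hq]
  rcases eq_or_ne q 1 with h1 | h1
  · simp [h1]
  · have hsub : q - 1 ≠ 0 := sub_ne_zero.2 h1
    have hsq : q ^ 2 - 1 ≠ 0 := by
      rw [show q ^ 2 - 1 = (q - 1) * (q + 1) by ring]
      exact mul_ne_zero hsub hne
    field_simp
    ring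

theorem mem_slitPlane_of_abs_arg_lt_pi {w : ℂ} (hw : w ≠ 0) (h : |arg w| < Real.pi) :
    w ∈ slitPlane :=
  mem_slitPlane_iff_arg.2 ⟨fun hπ => by simp [hπ, abs_of_pos Real.pi_pos] at h, hw⟩

theorem mul_logDeriv_sectorToDisk_of_abs_arg_eq {β : ℝ} {u : ℂ} (hβ0 : 0 < β) (hβ2 : β < 2)
    (hu0 : u ≠ 0) (hu : |arg u| = Real.pi / 2 * β) :
    u * logDeriv (sectorToDisk β) u =
      (((‖u‖ ^ β⁻¹ + (‖u‖ ^ β⁻¹)⁻¹) / 2 * (2 / Real.pi * arg u) : ℝ) * I)⁻¹ := by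
  have hpi := Real.pi_pos
  have hslit := mem_slitPlane_of_abs_arg_lt_pi hu0 (by rw [hu]; nlinarith)
  rw [mul_logDeriv_sectorToDisk hslit (cpow_inv_add_one_ne_zero hβ0 hu.le),
    cpow_inv_of_abs_arg_eq hβ0 hu]
  set a := ‖u‖ ^ β⁻¹
  set σ := 2 / Real.pi * arg u / β with hσ
  have hσsq : σ ^ 2 = 1 := by
    rw [hσ, div_pow, mul_pow, ← sq_abs (arg u), hu]
    field_simp
  have hσarg : 2 / Real.pi * arg u = β * σ := by rw [hσ]; field_simp
  have hinv : ((a : ℂ) * σ * I)⁻¹ = -(a⁻¹ * σ * I) := by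
    have hσinv : (σ : ℂ)⁻¹ = σ := inv_eq_of_mul_eq_one_left (by exact_mod_cast sq σ ▸ hσsq)
    rw [mul_inv, mul_inv, hσinv, inv_I]
    push_cast
    ring
  rw [hσarg, hinv, ← inv_div]
  push_cast
  ring

theorem analyticOrderAt_sub_le_comp {f g : ℂ → ℂ} {z₀ : ℂ} (hg : AnalyticAt ℂ g (f z₀))
    (hf : AnalyticAt ℂ f z₀) (h0 : g (f z₀) = 0) :
    analyticOrderAt (f · - f z₀) z₀ ≤ analyticOrderAt (g ∘ f) z₀ := by
  rw [hg.analyticOrderAt_comp hf]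
  exact le_mul_of_one_le_left' (Order.one_le_iff_ne_zero.2 (hg.analyticOrderAt_ne_zero.2 h0))

theorem natCast_le_mul_logDeriv_comp {p S : ℂ → ℂ} {n : ℕ} {z₀ : ℂ}
    (hp : DifferentiableOn ℂ p (ball 0 ‖z₀‖)) (hpz₀ : DifferentiableAt ℂ p z₀)
    (hn : n ≤ analyticOrderAt (p · - p 0) 0)
    (hS : ∀ z ∈ ball (0 : ℂ) ‖z₀‖, AnalyticAt ℂ S (p z)) (hSz₀ : DifferentiableAt ℂ S (p z₀))
    (hS0 : S (p 0) = 0) (hS₀ : S (p z₀) ≠ 0)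
    (hmax : IsMaxOn (fun z => ‖S (p z)‖) (closedBall 0 ‖z₀‖) z₀) :
    n ≤ z₀ * (logDeriv S (p z₀) * deriv p z₀) := by
  have hz₀ : z₀ ≠ 0 := fun h => hS₀ (h ▸ hS0)
  have hball : ball 0 ‖z₀‖ ∈ 𝓝 (0 : ℂ) := ball_mem_nhds _ (norm_pos_iff.2 hz₀)
  have hord : n ≤ analyticOrderAt (S ∘ p) 0 :=
    hn.trans (analyticOrderAt_sub_le_comp (hS 0 (mem_of_mem_nhds hball)) (hp.analyticAt hball) hS0)
  have hdiff : DifferentiableOn ℂ (S ∘ p) (ball 0 ‖z₀‖) := fun z hz =>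
    ((hS z hz).differentiableAt.comp z
      (hp.differentiableAt (isOpen_ball.mem_nhds hz))).differentiableWithinAt
  rw [← logDeriv_comp hSz₀ hpz₀]
  exact natCast_le_mul_logDeriv_of_isMaxOn_norm hdiff (hSz₀.comp z₀ hpz₀) hmax hS₀ hord

-- Nunokawa's lemma: Jack's lemma for `sectorToDisk β ∘ p`.
theorem exists_mul_logDeriv_eq_of_abs_arg_eq {p : ℂ → ℂ} {β : ℝ} {n : ℕ} {z₀ : ℂ} (hβ0 : 0 < β)
    (hβ2 : β < 2) (hp : DifferentiableOn ℂ p (ball 0 ‖z₀‖)) (hpz₀ : DifferentiableAt ℂ p z₀)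
    (hp0 : p 0 = 1) (hn : n ≤ analyticOrderAt (p · - 1) 0)
    (hne : ∀ z ∈ ball (0 : ℂ) ‖z₀‖, p z ≠ 0) (hne₀ : p z₀ ≠ 0)
    (hle : ∀ z ∈ closedBall (0 : ℂ) ‖z₀‖, |arg (p z)| ≤ Real.pi / 2 * β)
    (heq : |arg (p z₀)| = Real.pi / 2 * β) :
    ∃ k : ℝ, n / 2 * (‖p z₀‖ ^ β⁻¹ + (‖p z₀‖ ^ β⁻¹)⁻¹) ≤ k ∧
      z₀ * logDeriv p z₀ = (2 / Real.pi * k * arg (p z₀) : ℝ) * I := by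
  have hpi := Real.pi_pos
  have hS : ∀ z ∈ closedBall (0 : ℂ) ‖z₀‖, p z ≠ 0 → AnalyticAt ℂ (sectorToDisk β) (p z) :=
    fun z hz h => analyticAt_sectorToDisk
      (mem_slitPlane_of_abs_arg_lt_pi h ((hle z hz).trans_lt (by nlinarith)))
      (cpow_inv_add_one_ne_zero hβ0 (hle z hz))
  have hSz₀ := (hS z₀ (by simp) hne₀).differentiableAt
  have hnorm : ‖sectorToDisk β (p z₀)‖ = 1 := norm_sectorToDisk_eq_one hβ0 heq
  have hJack : n ≤ z₀ * (logDeriv (sectorToDisk β) (p z₀) * deriv p z₀) :=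
    natCast_le_mul_logDeriv_comp hp hpz₀ (by rwa [hp0])
      (fun z hz => hS z (ball_subset_closedBall hz) (hne z hz)) hSz₀
      (by rw [hp0, sectorToDisk_one]) (norm_ne_zero_iff.1 (by simp [hnorm]))
      (fun z hz => (norm_sectorToDisk_le_one hβ0 (hle z hz)).trans_eq hnorm.symm)
  have hfactor : z₀ * (logDeriv (sectorToDisk β) (p z₀) * deriv p z₀) =
      p z₀ * logDeriv (sectorToDisk β) (p z₀) * (z₀ * logDeriv p z₀) := by
    rw [logDeriv_apply p]
    field_simp
  rw [hfactor, mul_logDeriv_sectorToDisk_of_abs_arg_eq hβ0 hβ2 hne₀ heq] at hJack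
  set b := (‖p z₀‖ ^ β⁻¹ + (‖p z₀‖ ^ β⁻¹)⁻¹) / 2 with hb
  have : 0 < b := by have := norm_pos_iff.2 hne₀; positivity
  have harg : arg (p z₀) ≠ 0 := abs_pos.1 (heq ▸ by positivity)
  have hc0 : ((b * (2 / Real.pi * arg (p z₀)) : ℝ) : ℂ) * I ≠ 0 :=
    mul_ne_zero (by exact_mod_cast (by positivity)) I_ne_zero
  have hreal := eq_re_of_ofReal_le (r := n) (by exact_mod_cast hJack)
  set m := (((b * (2 / Real.pi * arg (p z₀)) : ℝ) * I)⁻¹ * (z₀ * logDeriv p z₀)).re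
  have hnm : (n : ℝ) ≤ m := by simpa only [natCast_re] using (le_def.1 hJack).1
  refine ⟨m * b, by rw [hb]; linear_combination b * hnm, ?_⟩
  rw [inv_mul_eq_iff_eq_mul₀ hc0] at hreal
  rw [hreal]
  push_cast
  ring

theorem exists_first_zero {E : Type*} [NormedAddCommGroup E] [NormedSpace ℝ E] [ProperSpace E]
    {g : E → ℝ} {R : ℝ} (hg : ContinuousOn g (ball 0 R)) (h0 : 0 < g 0) {z₁ : E}
    (hz₁ : z₁ ∈ ball 0 R) (hgz₁ : g z₁ ≤ 0) :
    ∃ z₀ ∈ ball (0 : E) R, g z₀ = 0 ∧ (∀ z ∈ ball (0 : E) ‖z₀‖, 0 < g z) ∧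
      ∀ z ∈ closedBall (0 : E) ‖z₀‖, 0 ≤ g z := by
  have hsub : ∀ z ∈ ball (0 : E) R, closedBall (0 : E) ‖z‖ ⊆ ball 0 R :=
    fun z hz => closedBall_subset_ball (mem_ball_zero_iff.1 hz)
  have hcompact : IsCompact (closedBall (0 : E) ‖z₁‖ ∩ g ⁻¹' Set.Iic 0) :=
    (isCompact_closedBall _ _).of_isClosed_subset
      ((hg.mono (hsub z₁ hz₁)).preimage_isClosed_of_isClosed isClosed_closedBall isClosed_Iic)
      Set.inter_subset_left
  obtain ⟨z₀, ⟨hz₀le, hgz₀⟩, hmin⟩ :=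
    hcompact.exists_isMinOn ⟨z₁, by simp, hgz₁⟩ continuous_norm.continuousOn
  have hz₀ : z₀ ∈ ball 0 R := hsub z₁ hz₁ hz₀le
  have hne : ‖z₀‖ ≠ 0 := norm_ne_zero_iff.2 fun h => (h ▸ h0).not_ge hgz₀
  have hpos : ∀ z ∈ ball (0 : E) ‖z₀‖, 0 < g z := by
    intro z hz
    by_contra! hgz
    rw [mem_ball_zero_iff] at hz
    rw [mem_closedBall_zero_iff] at hz₀le
    exact hz.not_ge (hmin (a := z) ⟨by simpa using hz.le.trans hz₀le, hgz⟩)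
  have hnonneg : ∀ z ∈ closedBall (0 : E) ‖z₀‖, 0 ≤ g z := by
    intro z hz
    have hcont : ContinuousWithinAt g (ball 0 ‖z₀‖) z :=
      (hg z (hsub z₀ hz₀ hz)).mono (ball_subset_closedBall.trans (hsub z₀ hz₀))
    rw [← closure_ball 0 hne] at hz
    exact continuousWithinAt_const.closure_le hz hcont fun y hy => (hpos y hy).le
  exact ⟨z₀, hz₀, le_antisymm hgz₀ (hnonneg z₀ (by simp)), hpos, hnonneg⟩

theorem exists_exit_point {p : ℂ → ℂ} {β R : ℝ} {n : ℕ} (hβ0 : 0 < β) (hβ1 : β ≤ 1)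
    (hp : DifferentiableOn ℂ p (ball 0 R)) (hp0 : p 0 = 1)
    (hn : n ≤ analyticOrderAt (p · - 1) 0) {z₁ : ℂ} (hz₁ : z₁ ∈ ball 0 R)
    (hexit : ¬ AbsArgLT (p z₁) (Real.pi / 2 * β)) :
    ∃ z ∈ ball (0 : ℂ) R, p z = 0 ∧ z * deriv p z ≤ 0 ∨
      p z ≠ 0 ∧ |arg (p z)| = Real.pi / 2 * β ∧
        ∃ k : ℝ, n / 2 * (‖p z‖ ^ β⁻¹ + (‖p z‖ ^ β⁻¹)⁻¹) ≤ k ∧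
          z * deriv p z = (2 / Real.pi * k * arg (p z) : ℝ) * I * p z := by
  have hpi := Real.pi_pos
  have h0 : 0 < Real.pi / 2 * β := by positivity
  have hπ2 : Real.pi / 2 * β ≤ Real.pi / 2 := by nlinarith
  have hπ : Real.pi / 2 * β ≤ Real.pi := by linarith
  obtain ⟨z₀, hz₀, heq, hlt, hle⟩ := exists_first_zero
    (g := fun z => (p z).re - ‖p z‖ * Real.cos (Real.pi / 2 * β))
    ((continuous_re.comp_continuousOn hp.continuousOn).sub
      (hp.continuousOn.norm.mul continuousOn_const))
    (by rw [sub_pos, ← absArgLT_iff h0.le hπ, hp0]; simp [AbsArgLT, h0]) hz₁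
    (by rwa [sub_nonpos, ← not_lt, ← absArgLT_iff h0.le hπ])
  simp only [sub_pos, sub_nonneg, ← absArgLT_iff h0.le hπ, ← abs_arg_le_iff h0.le hπ] at hlt hle
  have hdiff : DifferentiableAt ℂ p z₀ := hp.differentiableAt (isOpen_ball.mem_nhds hz₀)
  refine ⟨z₀, hz₀, ?_⟩
  by_cases hpz₀ : p z₀ = 0
  · left
    have hmax : IsMaxOn (fun z => (-p z).re) (closedBall 0 ‖z₀‖) z₀ := fun z hz => by
      simpa [hpz₀] using abs_arg_le_pi_div_two_iff.1 ((hle z hz).trans hπ2)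
    have := nonneg_mul_deriv_of_isMaxOn_re hdiff.neg hmax
    rw [deriv.neg, mul_neg, neg_nonneg] at this
    exact ⟨hpz₀, this⟩
  · right
    have harg : |arg (p z₀)| = Real.pi / 2 * β := by
      refine (hle z₀ (by simp)).antisymm (not_lt.1 fun h => ?_)
      exact ((absArgLT_iff h0.le hπ).1 ⟨hpz₀, h⟩).ne' (sub_eq_zero.1 heq)
    obtain ⟨k, hk, hderiv⟩ := exists_mul_logDeriv_eq_of_abs_arg_eq hβ0 (by linarith)
      (hp.mono (ball_subset_ball (mem_ball_zero_iff.1 hz₀).le)) hdiff hp0 hn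
      (fun z hz => (hlt z hz).1) hpz₀ hle harg
    refine ⟨hpz₀, harg, k, hk, ?_⟩
    rw [← hderiv, logDeriv_apply]
    field_simp

theorem two_le_add_inv {a : ℝ} (ha : 0 < a) : 2 ≤ a + a⁻¹ := by
  have : a + a⁻¹ - 2 = (a - 1) ^ 2 / a := by
    field_simp
    ring
  linarith [div_nonneg (sq_nonneg (a - 1)) ha.le]

theorem arg_one_add_ofReal_mul_I (t : ℝ) : arg (1 + t * I) = Real.arctan t := by
  rw [arg_eq_arctan_of_re_pos] <;> simp

theorem abs_arg_mul_one_add {v : ℂ} {c : ℝ} (hv : v ≠ 0) (hle : |arg v| ≤ Real.pi / 2)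
    (hc : 0 ≤ c) :
    |arg (v * (1 + (c * arg v : ℝ) * I))| = |arg v| + Real.arctan (c * |arg v|) := by
  have hbound := abs_le.1 hle
  have hlt := Real.arctan_lt_pi_div_two (c * arg v)
  have hgt := Real.neg_pi_div_two_lt_arctan (c * arg v)
  rw [arg_mul hv (fun h => by simpa using congrArg re h), arg_one_add_ofReal_mul_I]
  · rcases le_total 0 (arg v) with h | h
    · have hnonneg := Real.arctan_nonneg.2 (mul_nonneg hc h)
      rw [abs_of_nonneg h, abs_of_nonneg (by linarith)]
    · have hnonneg := Real.arctan_nonneg.2 (mul_nonneg hc (neg_nonneg.2 h))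
      rw [mul_neg, Real.arctan_neg] at hnonneg
      rw [abs_of_nonpos h, abs_of_nonpos (by linarith), mul_neg, Real.arctan_neg, neg_add]
  · rw [arg_one_add_ofReal_mul_I]
    constructor <;> linarith

theorem absArgLT_of_add_mul_deriv {p : ℂ → ℂ} {β R : ℝ} {n : ℕ} (hβ0 : 0 < β) (hβ1 : β ≤ 1)
    (hp : DifferentiableOn ℂ p (ball 0 R)) (hp0 : p 0 = 1)
    (hn : n ≤ analyticOrderAt (p · - 1) 0)
    (harg : ∀ z ∈ ball (0 : ℂ) R,
      AbsArgLT (p z + z * deriv p z) (Real.pi / 2 * β + Real.arctan (n * β))) :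
    ∀ z ∈ ball (0 : ℂ) R, AbsArgLT (p z) (Real.pi / 2 * β) := by
  have hpi := Real.pi_pos
  have hπ2 : Real.pi / 2 * β ≤ Real.pi / 2 := by nlinarith
  by_contra! ⟨z₁, hz₁, hexit⟩
  obtain ⟨z, hz, ⟨hp_zero, hneg⟩ | ⟨hp_ne, hp_arg, k, hk, hderiv⟩⟩ :=
    exists_exit_point hβ0 hβ1 hp hp0 hn hz₁ hexit
  · have hlt := harg z hz
    rw [hp_zero, zero_add] at hlt
    exact hlt.not_nonpos (by linarith [Real.arctan_lt_pi_div_two (n * β)]) hneg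
  · have hnk : n ≤ k := by
      have hpos : 0 < ‖p z‖ ^ β⁻¹ := Real.rpow_pos_of_pos (norm_pos_iff.2 hp_ne) _
      linarith [mul_le_mul_of_nonneg_left (two_le_add_inv hpos) (by positivity : 0 ≤ (n : ℝ) / 2)]
    have hk0 : 0 ≤ k := n.cast_nonneg.trans hnk
    have hfactor : p z + z * deriv p z = p z * (1 + (2 / Real.pi * k * arg (p z) : ℝ) * I) := by
      rw [hderiv]
      ring
    have hlt := (harg z hz).2
    rw [hfactor, abs_arg_mul_one_add hp_ne (hp_arg.trans_le hπ2) (by positivity), hp_arg,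
      show 2 / Real.pi * k * (Real.pi / 2 * β) = k * β by field_simp] at hlt
    exact hlt.not_ge (by gcongr)

theorem arg_mul_self_add_of_arg_pos {v : ℂ} {t : ℝ} (hv : 0 < arg v) (hle : arg v ≤ Real.pi / 2)
    (ht : 0 ≤ t) :
    arg (v * (v + t * I)) = arg v +
      (Real.pi / 2 - Real.arctan (Real.cos (arg v) / (Real.sin (arg v) + t / ‖v‖))) := by
  have hv0 : v ≠ 0 := by
    rintro rfl
    simp at hv
  have hnorm : 0 < ‖v‖ := norm_pos_iff.2 hv0
  have hsin : 0 < Real.sin (arg v) := Real.sin_pos_of_pos_of_lt_pi hv (by linarith [Real.pi_pos])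
  have hcos : 0 ≤ Real.cos (arg v) := Real.cos_nonneg_of_neg_pi_div_two_le_of_le (by linarith) hle
  have hre : (v + t * I).re = ‖v‖ * Real.cos (arg v) := by simp
  have him : (v + t * I).im = ‖v‖ * (Real.sin (arg v) + t / ‖v‖) := by
    rw [mul_add, norm_mul_sin_arg, mul_div_cancel₀ _ hnorm.ne']
    simp
  have him_pos : 0 < (v + t * I).im := by
    rw [him]
    positivity
  have harg : arg (v + t * I) =
      Real.pi / 2 - Real.arctan (Real.cos (arg v) / (Real.sin (arg v) + t / ‖v‖)) := by
    rw [arg_eq_pi_div_two_sub_arctan_of_im_pos him_pos, hre, him, mul_div_mul_left _ _ hnorm.ne']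
  rw [arg_mul hv0 (fun h => by simp [h] at him_pos), harg]
  have hnonneg : 0 ≤ Real.arctan (Real.cos (arg v) / (Real.sin (arg v) + t / ‖v‖)) :=
    Real.arctan_nonneg.2 (by positivity)
  rw [harg]
  have := Real.arctan_lt_pi_div_two (Real.cos (arg v) / (Real.sin (arg v) + t / ‖v‖))
  constructor <;> linarith

theorem abs_arg_mul_self_add {v : ℂ} {c : ℝ} (h0 : arg v ≠ 0) (hle : |arg v| ≤ Real.pi / 2)
    (hc : 0 ≤ c) :
    |arg (v * (v + (c * arg v : ℝ) * I))| = |arg v| + (Real.pi / 2 -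
      Real.arctan (Real.cos |arg v| / (Real.sin |arg v| + c * |arg v| / ‖v‖))) := by
  have hpos : ∀ w : ℂ, 0 < arg w → arg w ≤ Real.pi / 2 →
      |arg (w * (w + (c * arg w : ℝ) * I))| = arg w + (Real.pi / 2 -
        Real.arctan (Real.cos (arg w) / (Real.sin (arg w) + c * arg w / ‖w‖))) := by
    intro w hw hwle
    rw [arg_mul_self_add_of_arg_pos hw hwle (mul_nonneg hc hw.le), abs_of_nonneg]
    linarith [Real.arctan_lt_pi_div_two (Real.cos (arg w) / (Real.sin (arg w) + c * arg w / ‖w‖))]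
  rcases h0.lt_or_gt with h | h
  · have harg : arg (conj v) = |arg v| := by
      rw [arg_conj, if_neg (by linarith [Real.pi_pos]), abs_of_neg h]
    have hconj : conj (v * (v + (c * arg v : ℝ) * I)) =
        conj v * (conj v + (c * arg (conj v) : ℝ) * I) := by
      rw [harg, abs_of_neg h]
      simp
    rw [← abs_arg_conj, hconj, hpos _ (by rwa [harg, abs_pos]) (by rwa [harg]), harg, norm_conj]
  · rw [abs_of_pos h] at hle ⊢
    exact hpos v h hle

-- Weighted AM-GM with weights `(1 ± μ) / 2` for the two terms of `a ^ (1 - μ) + a ^ (-(1 + μ))`.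
theorem two_div_mul_rpow_le {μ a : ℝ} (hμ0 : 0 < μ) (hμ1 : μ < 1) (ha : 0 < a) :
    2 / (1 - μ) * ((1 - μ) / (1 + μ)) ^ ((1 + μ) / 2) ≤ (a + a⁻¹) / a ^ μ := by
  have hsub : 0 < 1 - μ := by linarith
  have : 0 < 1 + μ := by linarith
  set y := 2 / (1 - μ) * a ^ (-(1 + μ)) with hy
  set t := (1 - μ) / (1 + μ) * a ^ (2 : ℝ) with ht
  have hy0 : 0 < y := by positivity
  have ht0 : 0 < t := by positivity
  have hpow : a ^ (-(1 + μ)) = a⁻¹ / a ^ μ := by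
    rw [neg_add, Real.rpow_add ha, Real.rpow_neg_one, Real.rpow_neg ha.le]
    rfl
  have hgeom : (t * y) ^ ((1 + μ) / 2) * y ^ ((1 - μ) / 2) =
      2 / (1 - μ) * ((1 - μ) / (1 + μ)) ^ ((1 + μ) / 2) := by
    have hcancel : a ^ (2 * ((1 + μ) / 2)) * a ^ (-(1 + μ)) = 1 := by
      rw [← Real.rpow_add ha]
      ring_nf
      exact Real.rpow_zero a
    rw [Real.mul_rpow ht0.le hy0.le, mul_assoc, ← Real.rpow_add hy0,
      show (1 + μ) / 2 + (1 - μ) / 2 = 1 by ring, Real.rpow_one, ht,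
      Real.mul_rpow (by positivity) (by positivity), ← Real.rpow_mul ha.le, hy]
    linear_combination (2 / (1 - μ) * ((1 - μ) / (1 + μ)) ^ ((1 + μ) / 2)) * hcancel
  have harith : (1 + μ) / 2 * (t * y) + (1 - μ) / 2 * y = (a + a⁻¹) / a ^ μ := by
    rw [ht, hy, hpow, Real.rpow_two]
    field_simp
  rw [← hgeom, ← harith]
  exact Real.geom_mean_le_arith_mean2_weighted (by positivity) (by positivity) (by positivity)
    hy0.le (by ring)

theorem phiBound_le_of_le {n : ℕ} {μ a k : ℝ} (hμ0 : 0 < μ) (hμ1 : μ ≤ 1) (ha : 0 < a)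
    (hk : n / 2 * (a + a⁻¹) ≤ k) :
    phiBound n μ ≤ Real.pi / 2 * μ + (Real.pi / 2 - Real.arctan (Real.cos (Real.pi / 2 * μ) /
      (Real.sin (Real.pi / 2 * μ) + k * μ / a ^ μ))) := by
  have hpi := Real.pi_pos
  have hsin : 0 < Real.sin (Real.pi / 2 * μ) :=
    Real.sin_pos_of_pos_of_lt_pi (by positivity) (by nlinarith)
  have hcos : 0 ≤ Real.cos (Real.pi / 2 * μ) :=
    Real.cos_nonneg_of_neg_pi_div_two_le_of_le (by nlinarith) (by nlinarith)
  rw [phiBound, show μ * Real.pi / 2 = Real.pi / 2 * μ by ring, mul_add, mul_one, add_sub_assoc]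
  gcongr _ + (_ - ?_)
  apply Real.arctan_strictMono.monotone
  rcases hμ1.eq_or_lt with rfl | hμ1
  · simp
  have : 0 < 1 - μ := by linarith
  have hle : n * μ / (1 - μ) * ((1 - μ) / (1 + μ)) ^ ((1 + μ) / 2) ≤ k * μ / a ^ μ := by
    calc n * μ / (1 - μ) * ((1 - μ) / (1 + μ)) ^ ((1 + μ) / 2)
        = n / 2 * μ * (2 / (1 - μ) * ((1 - μ) / (1 + μ)) ^ ((1 + μ) / 2)) := by field_simp
      _ ≤ n / 2 * μ * ((a + a⁻¹) / a ^ μ) := by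
          gcongr
          exact two_div_mul_rpow_le hμ0 hμ1 ha
      _ = (n / 2 * (a + a⁻¹)) * μ / a ^ μ := by ring
      _ ≤ k * μ / a ^ μ := by gcongr
  gcongr

theorem phiBound_le_pi {n : ℕ} {μ : ℝ} (hμ0 : 0 < μ) (hμ1 : μ ≤ 1) : phiBound n μ ≤ Real.pi := by
  have hpi := Real.pi_pos
  have hsin : 0 < Real.sin (μ * Real.pi / 2) :=
    Real.sin_pos_of_pos_of_lt_pi (by positivity) (by nlinarith)
  have hcos : 0 ≤ Real.cos (μ * Real.pi / 2) :=
    Real.cos_nonneg_of_neg_pi_div_two_le_of_le (by nlinarith) (by nlinarith)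
  have : 0 ≤ 1 - μ := by linarith
  have harctan : 0 ≤ Real.arctan (Real.cos (μ * Real.pi / 2) / (Real.sin (μ * Real.pi / 2) +
      n * μ / (1 - μ) * ((1 - μ) / (1 + μ)) ^ ((1 + μ) / 2))) :=
    Real.arctan_nonneg.2 (by positivity)
  rw [phiBound]
  nlinarith

theorem absArgLT_of_sq_add_mul_deriv {p : ℂ → ℂ} {μ R : ℝ} {n : ℕ} (hμ0 : 0 < μ) (hμ1 : μ ≤ 1)
    (hp : DifferentiableOn ℂ p (ball 0 R)) (hp0 : p 0 = 1)
    (hn : n ≤ analyticOrderAt (p · - 1) 0)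
    (harg : ∀ z ∈ ball (0 : ℂ) R, AbsArgLT (p z ^ 2 + z * deriv p z) (phiBound n μ)) :
    ∀ z ∈ ball (0 : ℂ) R, AbsArgLT (p z) (Real.pi / 2 * μ) := by
  have hpi := Real.pi_pos
  by_contra! ⟨z₁, hz₁, hexit⟩
  obtain ⟨z, hz, ⟨hp_zero, hneg⟩ | ⟨hp_ne, hp_arg, k, hk, hderiv⟩⟩ :=
    exists_exit_point hμ0 hμ1 hp hp0 hn hz₁ hexit
  · have hlt := harg z hz
    rw [hp_zero, zero_pow two_ne_zero, zero_add] at hlt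
    exact hlt.not_nonpos (phiBound_le_pi hμ0 hμ1) hneg
  · have hnorm : 0 < ‖p z‖ := norm_pos_iff.2 hp_ne
    have hk0 : 0 ≤ k := le_trans (by positivity) hk
    have hfactor : p z ^ 2 + z * deriv p z =
        p z * (p z + (2 / Real.pi * k * arg (p z) : ℝ) * I) := by
      rw [hderiv]
      ring
    have hlt := (harg z hz).2
    rw [hfactor, abs_arg_mul_self_add (abs_pos.1 (hp_arg ▸ by positivity))
      (hp_arg.trans_le (by nlinarith)) (by positivity), hp_arg,
      show 2 / Real.pi * k * (Real.pi / 2 * μ) = k * μ by field_simp] at hlt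
    have hle := phiBound_le_of_le hμ0 hμ1 (Real.rpow_pos_of_pos hnorm _) hk
    rw [Real.rpow_inv_rpow hnorm.le hμ0.ne'] at hle
    exact hlt.not_ge hle

theorem mul_dslope_zero {F : ℂ → ℂ} (hF0 : F 0 = 0) (z : ℂ) : z * dslope F 0 z = F z := by
  simpa [hF0] using sub_smul_dslope F 0 z

theorem dslope_add_mul_deriv {F : ℂ → ℂ} {z : ℂ} (hF0 : F 0 = 0)
    (hd : DifferentiableAt ℂ (dslope F 0) z) :
    dslope F 0 z + z * deriv (dslope F 0) z = deriv F z := by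
  have hmul : F = fun z => z * dslope F 0 z := funext fun z => (mul_dslope_zero hF0 z).symm
  have hderiv := ((hasDerivAt_id z).fun_mul hd.hasDerivAt).deriv
  rw [id, one_mul] at hderiv
  conv_rhs => rw [hmul]
  exact hderiv.symm

theorem le_analyticOrderAt_dslope_sub_one {F : ℂ → ℂ} {n : ℕ∞} (hF0 : F 0 = 0)
    (hd : AnalyticAt ℂ (dslope F 0) 0) (hn : n + 1 ≤ analyticOrderAt (fun z => F z - z) 0) :
    n ≤ analyticOrderAt (dslope F 0 · - 1) 0 := by
  have hfactor : (fun z => F z - z) = id * fun z => dslope F 0 z - 1 := by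
    funext z
    simp only [Pi.mul_apply, id, ← mul_dslope_zero hF0 z]
    ring
  rw [hfactor, analyticOrderAt_mul (by fun_prop) (by fun_prop), analyticOrderAt_id,
    add_comm] at hn
  exact (ENat.add_le_add_iff_left ENat.one_ne_top).1 hn

theorem le_analyticOrderAt_div_sub_one {p q : ℂ → ℂ} {n : ℕ∞} (hp : AnalyticAt ℂ p 0)
    (hq : AnalyticAt ℂ q 0) (hq0 : ∀ᶠ z in 𝓝 0, q z ≠ 0)
    (hpn : n ≤ analyticOrderAt (p · - 1) 0) (hqn : n ≤ analyticOrderAt (q · - 1) 0) :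
    n ≤ analyticOrderAt (fun z => p z / q z - 1) 0 := by
  have hfactor : (fun z => p z / q z - 1) =ᶠ[𝓝 0] ((p · - 1) - (q · - 1)) * q⁻¹ := by
    filter_upwards [hq0] with z hz
    simp only [Pi.mul_apply, Pi.sub_apply, Pi.inv_apply]
    field_simp
    ring
  rw [analyticOrderAt_congr hfactor,
    analyticOrderAt_mul (by fun_prop) (hq.inv hq0.self_of_nhds)]
  exact (le_min hpn hqn).trans le_analyticOrderAt_sub |>.trans le_self_add

theorem div_sq_add_mul_deriv_div {p q : ℂ → ℂ} {z : ℂ} (hp : DifferentiableAt ℂ p z)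
    (hq : DifferentiableAt ℂ q z) (hq0 : q z ≠ 0) (hpq : q z + z * deriv q z = p z) :
    (p z / q z) ^ 2 + z * deriv (fun z => p z / q z) z = (p z + z * deriv p z) / q z := by
  rw [deriv_fun_div hp hq hq0]
  field_simp
  linear_combination -p z * hpq

theorem mem_classA_iff {f : ℂ → ℂ} {n : ℕ} :
    f ∈ classA n ↔ DifferentiableOn ℂ f (ball 0 1) ∧ f 0 = 0 ∧ deriv f 0 = 1 ∧
      n + 1 ≤ analyticOrderAt (fun z => f z - z) 0 := by
  rw [classA, Set.mem_ofPred_eq, analyticOnNhd_iff_differentiableOn isOpen_ball]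
  refine and_congr_right fun hf => and_congr_right fun hf0 => and_congr_right fun hf1 => ?_
  have han : AnalyticAt ℂ f 0 := hf.analyticAt (ball_mem_nhds _ one_pos)
  have hsub : ∀ k : ℕ, iteratedDeriv k (fun z => f z - z) 0 =
      iteratedDeriv k f 0 - iteratedDeriv k (fun z => z) 0 :=
    fun k => iteratedDeriv_fun_sub han.contDiffAt (by fun_prop)
  have hid : ∀ k : ℕ, iteratedDeriv (k + 2) (fun z : ℂ => z) 0 = 0 := by
    simp [iteratedDeriv_succ']
  rw [← Nat.cast_add_one, natCast_le_analyticOrderAt_iff_iteratedDeriv_eq_zero (by fun_prop)]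
  constructor
  · intro h k hk
    rw [hsub]
    match k with
    | 0 => simp [hf0]
    | 1 => simp [hf1]
    | k + 2 => rw [hid, h _ (by omega) (by omega), sub_zero]
  · intro h k hk hkn
    obtain ⟨m, rfl⟩ := Nat.exists_eq_add_of_le' hk
    simpa only [hsub, hid, sub_zero] using h (m + 2) (by omega)

theorem dslope_zero_of_mem_classA {f : ℂ → ℂ} {n : ℕ} (hf : f ∈ classA n) :
    DifferentiableOn ℂ (dslope f 0) (ball 0 1) ∧ dslope f 0 0 = 1 ∧
      n ≤ analyticOrderAt (dslope f 0 · - 1) 0 ∧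
      ∀ z ∈ ball (0 : ℂ) 1, dslope f 0 z + z * deriv (dslope f 0) z = deriv f z := by
  obtain ⟨hfd, hf0, hf1, hord⟩ := mem_classA_iff.1 hf
  have hball : ball (0 : ℂ) 1 ∈ 𝓝 0 := ball_mem_nhds _ one_pos
  have hd : DifferentiableOn ℂ (dslope f 0) (ball 0 1) := (differentiableOn_dslope hball).2 hfd
  exact ⟨hd, by rw [dslope_same, hf1],
    le_analyticOrderAt_dslope_sub_one hf0 (hd.analyticAt hball) hord,
    fun z hz => dslope_add_mul_deriv hf0 (hd.differentiableAt (isOpen_ball.mem_nhds hz))⟩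

theorem alexander_zero (f : ℂ → ℂ) : alexander f 0 = 0 := by
  simp [alexander]

theorem alexander_eq_of_hasDerivAt {f F : ℂ → ℂ} (hf : ContinuousOn (dslope f 0) (ball 0 1))
    (hf0 : f 0 = 0) (hF0 : F 0 = 0) (hF : ∀ z ∈ ball (0 : ℂ) 1, HasDerivAt F (dslope f 0 z) z)
    {z : ℂ} (hz : z ∈ ball (0 : ℂ) 1) : alexander f z = F z := by
  have hmem : ∀ s ∈ Set.uIcc (0 : ℝ) 1, (s : ℂ) * z ∈ ball (0 : ℂ) 1 := by
    intro s hs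
    rw [Set.uIcc_of_le zero_le_one] at hs
    rw [mem_ball_zero_iff] at hz ⊢
    rw [norm_mul, norm_real, Real.norm_of_nonneg hs.1]
    exact (mul_le_of_le_one_left (norm_nonneg z) hs.2).trans_lt hz
  have hintegrand : ∀ s : ℝ, s ∈ Set.uIoc 0 1 →
      f (s * z) / (s * z) * z = dslope f 0 (s * z) * z := by
    intro s hs
    rw [Set.uIoc_of_le zero_le_one] at hs
    rcases eq_or_ne z 0 with rfl | hz0
    · simp
    · have hs0 : (s : ℂ) ≠ 0 := by exact_mod_cast hs.1.ne'
      rw [← mul_dslope_zero hf0, mul_div_cancel_left₀ _ (mul_ne_zero hs0 hz0)]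
  have hderiv : ∀ s ∈ Set.uIcc (0 : ℝ) 1,
      HasDerivAt (fun s : ℝ => F (s * z)) (dslope f 0 (s * z) * z) s := fun s hs =>
    ((hF _ (hmem s hs)).comp (s : ℂ) (hasDerivAt_mul_const z)).comp_ofReal
  have hcont : ContinuousOn (fun s : ℝ => dslope f 0 (s * z) * z) (Set.uIcc 0 1) :=
    (hf.comp (by fun_prop) hmem).mul continuousOn_const
  rw [alexander, intervalIntegral.integral_congr_ae (Eventually.of_forall hintegrand),
    intervalIntegral.integral_eq_sub_of_hasDerivAt hderiv hcont.intervalIntegrable]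
  simp [hF0]

theorem hasDerivAt_alexander {f : ℂ → ℂ} (hf : DifferentiableOn ℂ f (ball 0 1)) (hf0 : f 0 = 0)
    {z : ℂ} (hz : z ∈ ball (0 : ℂ) 1) : HasDerivAt (alexander f) (dslope f 0 z) z := by
  have hd := (differentiableOn_dslope (ball_mem_nhds 0 one_pos)).2 hf
  obtain ⟨F, hF0, hF⟩ := hd.isExactOn_ball.with_val_at 0 0
  refine (hF z hz).congr_of_eventuallyEq ?_
  filter_upwards [isOpen_ball.mem_nhds hz] with y hy
  exact alexander_eq_of_hasDerivAt hd.continuousOn hf0 hF0 hF hy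

theorem alexander_mem_classA {f : ℂ → ℂ} {n : ℕ} (hf : f ∈ classA n) :
    alexander f ∈ classA n := by
  obtain ⟨hfd, hf0, -, -⟩ := mem_classA_iff.1 hf
  obtain ⟨-, hp0, hpn, -⟩ := dslope_zero_of_mem_classA hf
  have hball : ball (0 : ℂ) 1 ∈ 𝓝 0 := ball_mem_nhds _ one_pos
  have hF := fun z (hz : z ∈ ball (0 : ℂ) 1) => hasDerivAt_alexander hfd hf0 hz
  have hFd : DifferentiableOn ℂ (alexander f) (ball 0 1) := fun z hz =>
    (hF z hz).differentiableAt.differentiableWithinAt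
  have hFan : AnalyticAt ℂ (alexander f) 0 := hFd.analyticAt hball
  have hderiv : deriv (fun z => alexander f z - z) =ᶠ[𝓝 0] (dslope f 0 · - 1) := by
    filter_upwards [hball] with z hz
    exact ((hF z hz).sub (hasDerivAt_id z)).deriv
  refine mem_classA_iff.2 ⟨hFd, alexander_zero f, ?_, ?_⟩
  · rw [(hF 0 (mem_of_mem_nhds hball)).deriv, hp0]
  · rwa [← analyticOrderAt_deriv_ge_iff (by fun_prop) (by simp [alexander_zero]),
      analyticOrderAt_congr hderiv]

theorem pi_div_two_mul_eq_add {x y θ : ℝ} (h : x = y + 2 / Real.pi * θ) :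
    Real.pi / 2 * x = Real.pi / 2 * y + θ := by
  have := Real.pi_pos
  rw [h]
  field_simp

theorem le_and_le_one_of_add_le_two {n : ℕ} {α β γ : ℝ} (hγ : 0 ≤ γ)
    (hαβ : α = β + 2 / Real.pi * Real.arctan (n * β))
    (hβγ : β = γ + 2 / Real.pi * Real.arctan (n * γ)) (h : α + γ ≤ 2) : γ ≤ β ∧ β ≤ 1 := by
  have hc : 0 ≤ 2 / Real.pi := by positivity
  have hγβ : γ ≤ β := by
    have := mul_nonneg hc (Real.arctan_nonneg.2 (mul_nonneg n.cast_nonneg hγ))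
    linarith
  have hmono : 2 / Real.pi * Real.arctan (n * γ) ≤ 2 / Real.pi * Real.arctan (n * β) := by
    gcongr
  exact ⟨hγβ, by linarith⟩

theorem absArgLT_div_of_add_mul_deriv {p q : ℂ → ℂ} {a b μ R : ℝ} {n : ℕ} (hμ0 : 0 < μ)
    (hμ1 : μ ≤ 1) (hp : DifferentiableOn ℂ p (ball 0 R)) (hq : DifferentiableOn ℂ q (ball 0 R))
    (hp0 : p 0 = 1) (hq0 : q 0 = 1) (hpn : n ≤ analyticOrderAt (p · - 1) 0)
    (hqn : n ≤ analyticOrderAt (q · - 1) 0)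
    (hpq : ∀ z ∈ ball (0 : ℂ) R, q z + z * deriv q z = p z)
    (hpa : ∀ z ∈ ball (0 : ℂ) R, AbsArgLT (p z + z * deriv p z) a)
    (hqb : ∀ z ∈ ball (0 : ℂ) R, AbsArgLT (q z) b) (hab : a + b ≤ phiBound n μ) :
    ∀ z ∈ ball (0 : ℂ) R, AbsArgLT (p z / q z) (Real.pi / 2 * μ) := by
  intro z hz
  have hball : ball (0 : ℂ) R ∈ 𝓝 0 := ball_mem_nhds _ (nonempty_ball.1 ⟨z, hz⟩)
  refine absArgLT_of_sq_add_mul_deriv (n := n) hμ0 hμ1 (hp.fun_div hq fun y hy => (hqb y hy).1)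
    (by rw [hp0, hq0, div_one]) ?_ (fun y hy => ?_) z hz
  · exact le_analyticOrderAt_div_sub_one (hp.analyticAt hball) (hq.analyticAt hball)
      (eventually_of_mem hball fun y hy => (hqb y hy).1) hpn hqn
  · have hy' := isOpen_ball.mem_nhds hy
    rw [div_sq_add_mul_deriv_div (hp.differentiableAt hy') (hq.differentiableAt hy')
      (hqb y hy).1 (hpq y hy)]
    have h := (hpa y hy).div (hqb y hy) (hab.trans (phiBound_le_pi hμ0 hμ1))
    exact ⟨h.1, h.2.trans_le hab⟩

theorem mem_classSTS_of_dslope {F : ℂ → ℂ} {n : ℕ} {μ : ℝ} (hF : F ∈ classA n)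
    (harg : ∀ z ∈ ball (0 : ℂ) 1, AbsArgLT (deriv F z / dslope F 0 z) (Real.pi / 2 * μ)) :
    F ∈ classSTS n μ := by
  refine ⟨hF, fun z hz hz0 => ?_⟩
  rw [← mul_dslope_zero hF.2.1 z, mul_div_mul_left _ _ hz0]
  exact ⟨mul_ne_zero hz0 (div_ne_zero_iff.1 (harg z hz).1).2, harg z hz⟩

theorem theorem2 (n : ℕ) (hn : 1 ≤ n) (α β γ μ : ℝ)
    (hα : 0 < α) (hγ : 0 < γ) (hμ0 : 0 < μ) (hμ1 : μ ≤ 1)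
    (hαβ : α = β + 2 / Real.pi * Real.arctan (n * β))
    (hβγ : β = γ + 2 / Real.pi * Real.arctan (n * γ))
    (hφ : Real.pi / 2 * (α + γ) ≤ phiBound n μ)
    (f : ℂ → ℂ) (hf : f ∈ classA n)
    (harg : ∀ z ∈ Metric.ball (0 : ℂ) 1, AbsArgLT (deriv f z) (Real.pi / 2 * α)) :
    alexander f ∈ classSTS n μ := by
  have hsum : α + γ ≤ 2 := by
    have hπ := hφ.trans (phiBound_le_pi hμ0 hμ1)
    exact le_of_mul_le_mul_left (by linarith) Real.pi_div_two_pos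
  obtain ⟨hγβ, hβ1⟩ := le_and_le_one_of_add_le_two hγ.le hαβ hβγ hsum
  have hF := alexander_mem_classA hf
  have hF' : ∀ z ∈ ball (0 : ℂ) 1, deriv (alexander f) z = dslope f 0 z := fun z hz =>
    (hasDerivAt_alexander hf.1.differentiableOn hf.2.1 hz).deriv
  obtain ⟨hpd, hp0, hpn, hp'⟩ := dslope_zero_of_mem_classA hf
  obtain ⟨hqd, hq0, hqn, hq'⟩ := dslope_zero_of_mem_classA hF
  have hpa : ∀ z ∈ ball (0 : ℂ) 1, AbsArgLT (dslope f 0 z + z * deriv (dslope f 0) z)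
      (Real.pi / 2 * α) := fun z hz => (hp' z hz).symm ▸ harg z hz
  have hpq : ∀ z ∈ ball (0 : ℂ) 1, dslope (alexander f) 0 z + z * deriv (dslope (alexander f) 0) z =
      dslope f 0 z := fun z hz => (hq' z hz).trans (hF' z hz)
  have hp := absArgLT_of_add_mul_deriv (hγ.trans_le hγβ) hβ1 hpd hp0 hpn
    (pi_div_two_mul_eq_add hαβ ▸ hpa)
  have hq := absArgLT_of_add_mul_deriv hγ (hγβ.trans hβ1) hqd hq0 hqn fun z hz => by
    rw [hpq z hz, ← pi_div_two_mul_eq_add hβγ]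
    exact hp z hz
  refine mem_classSTS_of_dslope hF fun z hz => ?_
  rw [hF' z hz]
  exact absArgLT_div_of_add_mul_deriv hμ0 hμ1 hpd hqd hp0 hq0 hpn hqn hpq hpa hq
    (by rwa [← mul_add]) z hz
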